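/- **Setting.** Let $0\le q<p\le 1$. A stochastic block model with parameters $p,q$ on a finite node set partitioned into communities is a random symmetric $0/1$ weight matrix $W$ whose entries $W_{ij}$ (one for each unordered pair $\{i,j\}$, $i=j$ allowed) are independent, with $\Pr(W_{ij}=1)=p$ if $i,j$ belong to the same community and $\Pr(W_{ij}=1)=q$ otherwise. Let $\alpha_0,\beta,\gamma$ be disjoint sets of nodes with $|\alpha_0|=|\beta|=l$ and $|\gamma|=s$. Let $W_A$ and $W_B$ be random weight matrices on $\alpha_0\cup\beta\cup\gamma$, defined on a common probability space with arbitrary mutual dependence, such that $W_A$ follows the stochastic block model with the two communities $\alpha_0$ and $\beta\cup\gamma$ (sizes $l$ and $l+s$), and $W_B$ follows the stochastic block model with the three communities $\alpha_0,\beta,\gamma$ (sizes $l,l,s$), both with parameters $p,q$. The $d$ leading eigenvectors of a real symmetric matrix are the first $d$ vectors of an orthonormal basis of eigenvectors ordered by decreasing eigenvalue. Let $u_1,u_2$ be the two leading eigenvectors of $W_A$, let $Q_{W_A}=I-u_1u_1^T-u_2u_2^T$, and let $\tilde v_\gamma$ be the leading unit eigenvector of $Q_{W_A}W_BQ_{W_A}$,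 with its sign chosen so that $\sum_{i\in\gamma}(\tilde v_\gamma)_i\ge 0$. Estimate $\gamma$ by $\hat\gamma=\{i : (\tilde v_\gamma)_i>\frac{1}{2\sqrt s}\}$, and let $N_\epsilon=|\hat\gamma\,\triangle\,\gamma|$ be the number of misclassified nodes. **Theorem.** There are constants $C_2,C_3>0$ and $L$, depending only on $p$ and $q$, such that for every real $\alpha$ with $\frac12<\alpha<1$ and all integers $l,s\ge L$ with $s=l^\alpha$, with probability at least $1-\exp(-l)$, for every choice of the leading eigenvectors above, $$\frac{N_\epsilon}{s}\le\begin{cases} C_2\, l^{1-2\alpha}, & \tfrac12<\alpha\le \tfrac23,\\[2pt] C_3\, l^{\alpha-1}, & \tfrac23<\alpha<1.\end{cases}$$ -/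

import Mathlib

namespace TwoSBM

open MeasureTheory ProbabilityTheory

/-- The `2l + s` nodes shared by the two graphs: the three summands are the communities
`α` (size `l`), `β` (size `l`) and `γ` (size `s`). -/
abbrev Node (l s : ℕ) : Type := Fin l ⊕ Fin l ⊕ Fin s

/-- Community labels in `G_A`: the first community is `α`, the second one is `β ∪ γ`
(sizes `l` and `l + s`). -/
def commA {l s : ℕ} : Node l s → Fin 2
  | Sum.inl _ => 0
  | Sum.inr _ => 1

/-- Community labels in `G_B`: `α`, `β` and `γ` (sizes `l`, `l` and `s`). -/
def commB {l s : ℕ} : Node l s → Fin 3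
  | Sum.inl _ => 0
  | Sum.inr (Sum.inl _) => 1
  | Sum.inr (Sum.inr _) => 2

/-- The differentiating community `γ`. -/
def gamma (l s : ℕ) : Set (Node l s) := {i | commB i = 2}

/-- `X` is the family of edge weights of a stochastic block model on the node set `V` with
community labels `c`, and connection probabilities `p` inside the communities and `q` between
them: the weights, one for each unordered pair of nodes (an edge from a node to itself
included), are independent random variables with values in `{0, 1}`. -/
structure IsSBM {Ω V K : Type*} [MeasurableSpace Ω] [DecidableEq K] (μ : Measure Ω)
    (X : Sym2 V → Ω → ℝ) (c : V → K) (p q : ℝ) : Prop where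
  measurable : ∀ e, Measurable (X e)
  zero_or_one : ∀ e ω, X e ω = 0 ∨ X e ω = 1
  prob_eq_one : ∀ i j : V, μ.real {ω | X s(i, j) ω = 1} = if c i = c j then p else q
  indep : iIndepFun X μ

/-- The symmetric weight matrix with the given edge weights. -/
def weightMatrix {Ω V : Type*} (X : Sym2 V → Ω → ℝ) (ω : Ω) : Matrix V V ℝ :=
  Matrix.of fun i j => X s(i, j) ω

/-- `u 0, …, u (d - 1)` are `d` leading eigenvectors of the symmetric matrix `M`: the first `d`
vectors of an orthonormal basis of eigenvectors whose eigenvalues are in decreasing order. -/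
def AreLeadingEigenvectors {V : Type*} [Fintype V] {d : ℕ} (M : Matrix V V ℝ)
    (u : Fin d → EuclideanSpace ℝ V) : Prop :=
  ∃ (b : OrthonormalBasis (Fin (Fintype.card V)) ℝ (EuclideanSpace ℝ V))
    (ev : Fin (Fintype.card V) → ℝ) (hd : d ≤ Fintype.card V),
    Antitone ev ∧
    (∀ i, M.mulVec (b i).ofLp = ev i • (b i).ofLp) ∧
    ∀ k : Fin d, u k = b (Fin.castLE hd k)

/-- The matrix `Q = I - u₀ u₀ᵀ - u₁ u₁ᵀ`. -/
def complementProj {V : Type*} [DecidableEq V] (u : Fin 2 → EuclideanSpace ℝ V) :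
    Matrix V V ℝ :=
  1 - Matrix.vecMulVec (u 0).ofLp (u 0).ofLp - Matrix.vecMulVec (u 1).ofLp (u 1).ofLp

/-- The number of nodes that are misclassified when the community `γ` is estimated by the set of
nodes at which the entry of `v` exceeds the threshold `1 / (2 √s)`. -/
noncomputable def numErrors {l s : ℕ} (v : EuclideanSpace ℝ (Node l s)) : ℕ :=
  (symmDiff {i | 1 / (2 * √(s : ℝ)) < v i} (gamma l s)).ncard

end TwoSBM

/-!
The bound `N / s ≤ C l ^ (1 - 2 α)`, that is `N / s ≤ C l / s ²`, holds in the whole range of `α`;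
for `α > 2 / 3` it is stronger than `C l ^ (α - 1)`. It holds as soon as both weight matrices are
within `15 √l` of their means in operator norm. This has probability at least `1 - exp (-l)` by
Hoeffding's inequality for the bilinear forms `xᵀ (W - E W) y` and a union bound over a net
(`TwoSBM.IsSBM.measureReal_opNorm_gt_le_exp`). The rest is deterministic linear algebra.

Let `f`, `y`, `z` be the indicator vectors of `α₀`, `β`, `γ`, let `g = y + z` and let
`w = z - s / (l + s) g` be the part of `z` orthogonal to `g`. The mean `M` of `W_A` is positive
semidefinite of rank two, with range spanned by `f` and `g`, and is at least `(p - q) l` there. By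
min-max, the first two eigenvalues of `W_A` are of order `l`, and the others of order `√l`. Hence
the deflation `Q` moves `w`, which is in the kernel of `M`, by `O(√l ‖w‖ / l) = O(1)`; and as
`g = M x` for some `x` of norm `O(1 / √l)`, also `‖Q g‖ = O(1)`. The mean of `W_B` is
`M - (p - q) (y zᵀ + z yᵀ)`, `Q z` is `w` up to `O(1)`, and `Q y` is `-w` up to `O(1)`, while
`Q W_A` is `O(√l)`. So `Q W_B Q = 2 (p - q) w wᵀ + O(√l)`
(`OrthonormalBasis.norm_deflate_apply_deflate_sub_le`).

The eigenvalue `2 (p - q) ‖w‖ ²` is at least `(p - q) s`, so by a Davis–Kahan argument the leading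
eigenvector is within `O(√l / s)` of `w / ‖w‖`, the sign being fixed by the sum over `γ`
(`OrthonormalBasis.norm_sub_normalized_splitVector_sq_le`). The entries of `w / ‖w‖` are at least
`7 / (10 √s)` on `γ` and at most `0` elsewhere, so every misclassified node contributes at least
`1 / (25 s)` to the squared distance (`TwoSBM.numErrors_le`).
-/

open MeasureTheory ProbabilityTheory
open scoped RealInnerProductSpace

/-! ### Operator norms and separated nets -/

/-- The ball of radius `2` in a Euclidean space of dimension `n` has a net of mesh `1` with at most
`5 ^ n` points, namely any maximal `1`-separated subset. -/
theorem exists_finset_net (E : Type*) [NormedAddCommGroup E] [NormedSpace ℝ E]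
    [FiniteDimensional ℝ E] :
    ∃ N : Finset E, (∀ c ∈ N, ‖c‖ ≤ 2) ∧ N.card ≤ 5 ^ Module.finrank ℝ E ∧
      ∀ x : E, ‖x‖ ≤ 2 → ∃ c ∈ N, ‖x - c‖ ≤ 1 := by
  classical
  let S : Set ℕ := {k | ∃ s : Finset E, (∀ c ∈ s, ‖c‖ ≤ 2) ∧
    (∀ c ∈ s, ∀ d ∈ s, c ≠ d → 1 ≤ ‖c - d‖) ∧ s.card = k}
  have hb : BddAbove S := by
    refine ⟨5 ^ Module.finrank ℝ E, ?_⟩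
    rintro k ⟨s, hs, hd, rfl⟩
    exact Besicovitch.card_le_of_separated s hs hd
  have hne : S.Nonempty := ⟨0, ∅, by simp⟩
  obtain ⟨N, hN, hsep, hcard⟩ := Nat.sSup_mem hne hb
  refine ⟨N, hN, Besicovitch.card_le_of_separated N hN hsep, fun x hx => ?_⟩
  by_contra! hcon
  have hxN : x ∉ N := fun h => by
    have := hcon x h
    simp at this
    linarith
  have hmem : N.card + 1 ∈ S := by
    refine ⟨insert x N, ?_, ?_, Finset.card_insert_of_notMem hxN⟩
    · intro c hc
      rcases Finset.mem_insert.1 hc with rfl | hc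
      exacts [hx, hN c hc]
    · intro c hc d hd hcd
      rcases Finset.mem_insert.1 hc with rfl | hc' <;> rcases Finset.mem_insert.1 hd with rfl | hd'
      · exact absurd rfl hcd
      · exact (hcon d hd').le
      · rw [norm_sub_rev]; exact (hcon c hc').le
      · exact hsep c hc' d hd' hcd
  have := le_csSup hb hmem
  omega

section Net

variable {E : Type*} [NormedAddCommGroup E] [InnerProductSpace ℝ E]

theorem exists_mem_net_norm_smul_sub_le {N : Finset E}
    (hN : ∀ x : E, ‖x‖ ≤ 2 → ∃ c ∈ N, ‖x - c‖ ≤ 1) {z : E} (hz : z ≠ 0) :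
    ∃ c ∈ N, ‖(2 / ‖z‖) • z - c‖ ≤ 1 := by
  refine hN _ ?_
  have : 0 < ‖z‖ := norm_pos_iff.2 hz
  rw [norm_smul, Real.norm_of_nonneg (by positivity), div_mul_cancel₀ _ this.ne']

theorem norm_le_of_forall_net_inner_le {N : Finset E}
    (hN : ∀ x : E, ‖x‖ ≤ 2 → ∃ c ∈ N, ‖x - c‖ ≤ 1) {t : ℝ} (ht : 0 ≤ t) {z : E}
    (h : ∀ c ∈ N, ⟪c, z⟫ ≤ t) : ‖z‖ ≤ t := by
  rcases eq_or_ne z 0 with rfl | hz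
  · simpa using ht
  obtain ⟨c, hc, hcz⟩ := exists_mem_net_norm_smul_sub_le hN hz
  have hz' : 0 < ‖z‖ := norm_pos_iff.2 hz
  have h1 : ⟪(2 / ‖z‖) • z, z⟫ = 2 * ‖z‖ := by
    rw [real_inner_smul_left, real_inner_self_eq_norm_sq]
    field_simp
  have h2 : ⟪(2 / ‖z‖) • z, z⟫ = ⟪c, z⟫ + ⟪(2 / ‖z‖) • z - c, z⟫ := by
    rw [inner_sub_left]; ring
  have h3 := real_inner_le_norm ((2 / ‖z‖) • z - c) z
  nlinarith [h c hc]

/-- With a mesh equal to half the radius, no constant is lost: the error terms of the two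
discretizations are absorbed by the doubled radius. -/
theorem opNorm_le_of_forall_net_inner_le {N : Finset E}
    (hN : ∀ x : E, ‖x‖ ≤ 2 → ∃ c ∈ N, ‖x - c‖ ≤ 1) {t : ℝ} (ht : 0 ≤ t) (T : E →L[ℝ] E)
    (h : ∀ c ∈ N, ∀ d ∈ N, ⟪c, T d⟫ ≤ t) : ‖T‖ ≤ t := by
  have key : ‖T‖ ≤ (t + ‖T‖) / 2 := by
    refine T.opNorm_le_bound (by positivity) fun y => ?_
    rcases eq_or_ne y 0 with rfl | hy
    · simp
    obtain ⟨d, hd, hdy⟩ := exists_mem_net_norm_smul_sub_le hN hy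
    have hy' : 0 < ‖y‖ := norm_pos_iff.2 hy
    have h1 : ‖T d‖ ≤ t := norm_le_of_forall_net_inner_le hN ht fun c hc => h c hc d hd
    have h2 : ‖T ((2 / ‖y‖) • y)‖ ≤ ‖T d‖ + ‖T‖ := by
      calc ‖T ((2 / ‖y‖) • y)‖ = ‖T d + T ((2 / ‖y‖) • y - d)‖ := by rw [← map_add]; simp
        _ ≤ ‖T d‖ + ‖T‖ * ‖(2 / ‖y‖) • y - d‖ :=
          (norm_add_le _ _).trans (by gcongr; exact T.le_opNorm _)
        _ ≤ ‖T d‖ + ‖T‖ := by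
          have := mul_le_mul_of_nonneg_left hdy (norm_nonneg T)
          linarith
    rw [map_smul, norm_smul, Real.norm_of_nonneg (by positivity), div_mul_eq_mul_div,
      div_le_iff₀ hy'] at h2
    nlinarith
  linarith

end Net

/-! ### Concentration of the weight matrix of a stochastic block model -/

namespace TwoSBM

/-- The matrix of the expected weights of a stochastic block model. -/
def blockMean {V K : Type*} [DecidableEq K] (c : V → K) (p q : ℝ) : Matrix V V ℝ :=
  Matrix.of fun i j => if c i = c j then p else q

section Concentration

variable {Ω V K : Type*} [MeasurableSpace Ω] [DecidableEq K]
  {μ : Measure Ω} {X : Sym2 V → Ω → ℝ} {c : V → K} {p q : ℝ}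

theorem IsSBM.integral_eq (h : IsSBM μ X c p q) (i j : V) :
    ∫ ω, X s(i, j) ω ∂μ = blockMean c p q i j := by
  have h1 : X s(i, j) = Set.indicator {ω | X s(i, j) ω = 1} 1 := by
    funext ω
    rcases h.zero_or_one s(i, j) ω with h0 | h0 <;> simp [Set.indicator, h0]
  have hm : MeasurableSet {ω | X s(i, j) ω = 1} :=
    h.measurable s(i, j) (measurableSet_singleton 1)
  rw [h1, integral_indicator_one hm, h.prob_eq_one]
  rfl

variable [IsProbabilityMeasure μ] [Fintype V] [DecidableEq V]

/-- The coefficient of the weight of the edge `e` in the bilinear form `xᵀ W y`. -/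
def edgeCoeff (x y : V → ℝ) (e : Sym2 V) : ℝ :=
  ∑ ij : V × V with s(ij.1, ij.2) = e, x ij.1 * y ij.2

theorem sum_edgeCoeff_mul (x y : V → ℝ) (w : Sym2 V → ℝ) :
    ∑ e, edgeCoeff x y e * w e = ∑ i, ∑ j, x i * y j * w s(i, j) := by
  rw [← Fintype.sum_prod_type' (f := fun i j => x i * y j * w s(i, j)),
    ← Finset.sum_fiberwise Finset.univ (fun ij : V × V => s(ij.1, ij.2))]
  refine Finset.sum_congr rfl fun e _ => ?_
  rw [edgeCoeff, Finset.sum_mul]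
  refine Finset.sum_congr rfl fun ij hij => ?_
  rw [(Finset.mem_filter.1 hij).2]

/-- An unordered pair comes from at most two ordered pairs, whence the factor `2`. -/
theorem sum_edgeCoeff_sq_le (x y : EuclideanSpace ℝ V) :
    ∑ e, edgeCoeff x y e ^ 2 ≤ 2 * (‖x‖ ^ 2 * ‖y‖ ^ 2) := by
  have h1 : ∀ e : Sym2 V, edgeCoeff x y e ^ 2 ≤
      2 * ∑ ij : V × V with s(ij.1, ij.2) = e, (x ij.1 * y ij.2) ^ 2 := by
    intro e
    refine sq_sum_le_card_mul_sum_sq.trans ?_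
    refine mul_le_mul_of_nonneg_right ?_ (Finset.sum_nonneg fun _ _ => sq_nonneg _)
    induction e with
    | _ a b =>
      have : (Finset.univ.filter fun ij : V × V => s(ij.1, ij.2) = s(a, b)) ⊆
          {(a, b), (b, a)} := by
        intro ij hij
        have := (Finset.mem_filter.1 hij).2
        rw [Sym2.eq_iff] at this
        simpa [Prod.ext_iff] using this
      exact_mod_cast (Finset.card_le_card this).trans Finset.card_le_two
  refine (Finset.sum_le_sum fun e _ => h1 e).trans ?_
  rw [← Finset.mul_sum, Finset.sum_fiberwise Finset.univ (fun ij : V × V => s(ij.1, ij.2)),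
    EuclideanSpace.real_norm_sq_eq, EuclideanSpace.real_norm_sq_eq, Finset.sum_mul_sum,
    Fintype.sum_prod_type]
  simp [mul_pow]

/-- Hoeffding's inequality for the bilinear form of the centred weight matrix. -/
theorem IsSBM.measureReal_inner_ge_le (h : IsSBM μ X c p q) (x y : EuclideanSpace ℝ V)
    {r t : ℝ} (hx : ‖x‖ ^ 2 * ‖y‖ ^ 2 ≤ r) (ht : 0 < t) :
    μ.real {ω | t ≤ ⟪x, Matrix.toEuclideanCLM (𝕜 := ℝ)
      (weightMatrix X ω - blockMean c p q) y⟫} ≤ Real.exp (-t ^ 2 / r) := by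
  let Y : Sym2 V → Ω → ℝ := fun e ω => edgeCoeff x y e * (X e ω - μ[X e])
  have hind : iIndepFun Y μ :=
    h.indep.comp (fun e z => edgeCoeff x y e * (z - ∫ ω, X e ω ∂μ)) (fun e => by fun_prop)
  have hsub : ∀ e ∈ (Finset.univ : Finset (Sym2 V)),
      HasSubgaussianMGF (Y e) (Real.toNNReal (edgeCoeff x y e ^ 2 / 4)) μ := by
    intro e _
    have h1 := (hasSubgaussianMGF_of_mem_Icc (μ := μ) (X := X e) (a := 0) (b := 1) (h.measurable e).aemeasurable
      (Filter.Eventually.of_forall fun ω => by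
        rcases h.zero_or_one e ω with h0 | h0 <;> simp [h0])).const_mul (edgeCoeff x y e)
    convert h1 using 1
    refine NNReal.eq ?_
    rw [Real.coe_toNNReal _ (by positivity)]
    change _ = edgeCoeff x y e ^ 2 * (((‖(1 : ℝ) - 0‖₊ / 2) ^ 2 : NNReal) : ℝ)
    norm_num
    ring
  have hbound := HasSubgaussianMGF.measure_sum_ge_le_of_iIndepFun hind hsub ht.le
  have hset : {ω | t ≤ ⟪x, Matrix.toEuclideanCLM (𝕜 := ℝ)
      (weightMatrix X ω - blockMean c p q) y⟫} = {ω | t ≤ ∑ e, Y e ω} := by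
    ext ω
    have : ⟪x, Matrix.toEuclideanCLM (𝕜 := ℝ) (weightMatrix X ω - blockMean c p q) y⟫ =
        ∑ e, Y e ω := by
      rw [Matrix.inner_toEuclideanCLM, sum_edgeCoeff_mul x y (fun e => X e ω - μ[X e])]
      simp only [dotProduct, Matrix.mulVec, Finset.mul_sum, Matrix.sub_apply, h.integral_eq]
      refine Finset.sum_congr rfl fun i _ => Finset.sum_congr rfl fun j _ => ?_
      simp only [weightMatrix, Matrix.of_apply]
      ring
    simp only [Set.mem_ofPred_eq, this]
  rw [hset]
  have hV : 2 * ((∑ e, Real.toNNReal (edgeCoeff x y e ^ 2 / 4) : NNReal) : ℝ) =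
      (∑ e, edgeCoeff x y e ^ 2) / 2 := by
    rw [NNReal.coe_sum, Finset.sum_congr rfl fun e _ => Real.coe_toNNReal _ (by positivity),
      ← Finset.sum_div]
    ring
  have hle := sum_edgeCoeff_sq_le x y
  rcases (Finset.sum_nonneg fun e (_ : e ∈ (Finset.univ : Finset (Sym2 V))) =>
      sq_nonneg (edgeCoeff x y e)).eq_or_lt with h0 | h0
  · -- all coefficients vanish, and the event is empty
    have hz : ∀ e, edgeCoeff x y e = 0 := fun e => by
      have := (Finset.sum_eq_zero_iff_of_nonneg (fun e _ => sq_nonneg (edgeCoeff x y e))).1 h0.symm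
        e (Finset.mem_univ e)
      exact pow_eq_zero_iff two_ne_zero |>.1 this
    have : {ω | t ≤ ∑ e, Y e ω} = ∅ := by
      ext ω; simp [Y, hz, ht]
    rw [this, measureReal_empty]
    positivity
  · refine hbound.trans (Real.exp_le_exp.2 ?_)
    rw [hV, neg_div, neg_div, neg_le_neg_iff]
    gcongr
    linarith

theorem IsSBM.measureReal_opNorm_gt_le (h : IsSBM μ X c p q) {t : ℝ} (ht : 0 < t) :
    μ.real {ω | t < ‖Matrix.toEuclideanCLM (𝕜 := ℝ) (weightMatrix X ω - blockMean c p q)‖} ≤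
      25 ^ Fintype.card V * Real.exp (-t ^ 2 / 16) := by
  obtain ⟨N, hN2, hNc, hN⟩ := exists_finset_net (EuclideanSpace ℝ V)
  rw [finrank_euclideanSpace] at hNc
  have hsub : {ω | t < ‖Matrix.toEuclideanCLM (𝕜 := ℝ) (weightMatrix X ω - blockMean c p q)‖} ⊆
      ⋃ z ∈ N ×ˢ N, {ω | t ≤ ⟪z.1, Matrix.toEuclideanCLM (𝕜 := ℝ)
        (weightMatrix X ω - blockMean c p q) z.2⟫} := by
    intro ω hω
    by_contra hcon
    simp only [Set.mem_iUnion, Set.mem_ofPred_eq, not_exists, not_le, Finset.mem_product] at hcon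
    exact absurd hω (not_lt.2 (opNorm_le_of_forall_net_inner_le hN ht.le _
      fun c hc d hd => (hcon (c, d) ⟨hc, hd⟩).le))
  calc _ ≤ _ := measureReal_mono hsub (measure_ne_top _ _)
    _ ≤ ∑ z ∈ N ×ˢ N, μ.real {ω | t ≤ ⟪z.1, Matrix.toEuclideanCLM (𝕜 := ℝ)
        (weightMatrix X ω - blockMean c p q) z.2⟫} := measureReal_biUnion_finset_le _ _
    _ ≤ ∑ z ∈ N ×ˢ N, Real.exp (-t ^ 2 / 16) := by
      refine Finset.sum_le_sum fun z hz => h.measureReal_inner_ge_le z.1 z.2 ?_ ht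
      obtain ⟨h1, h2⟩ := Finset.mem_product.1 hz
      have h1 := hN2 _ h1
      have h2 := hN2 _ h2
      calc ‖z.1‖ ^ 2 * ‖z.2‖ ^ 2 ≤ 2 ^ 2 * 2 ^ 2 := by gcongr
        _ = 16 := by norm_num
    _ ≤ _ := by
      rw [Finset.sum_const, nsmul_eq_mul, Finset.card_product]
      gcongr
      calc ((N.card * N.card : ℕ) : ℝ) ≤ ((5 ^ Fintype.card V * 5 ^ Fintype.card V : ℕ) : ℝ) := by
            exact_mod_cast Nat.mul_le_mul hNc hNc
        _ = 25 ^ Fintype.card V := by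
          push_cast
          rw [← mul_pow]; norm_num

end Concentration

end TwoSBM

/-! ### Eigenbases and deflation -/

section Spectral

variable {ι H : Type*} [Fintype ι] [NormedAddCommGroup H] [InnerProductSpace ℝ H]

theorem OrthonormalBasis.inner_apply_of_eigen (b : OrthonormalBasis ι ℝ H) {A : H →ₗ[ℝ] H}
    {ev : ι → ℝ} (hA : ∀ i, A (b i) = ev i • b i) (i : ι) (x : H) :
    ⟪b i, A x⟫ = ev i * ⟪b i, x⟫ := by
  classical
  conv_lhs => rw [← b.sum_repr' x]
  simp [map_sum, inner_sum, inner_smul_right, hA, orthonormal_iff_ite.1 b.orthonormal, mul_comm]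

theorem OrthonormalBasis.norm_sq_eq_sum (b : OrthonormalBasis ι ℝ H) (x : H) :
    ‖x‖ ^ 2 = ∑ i, ⟪b i, x⟫ ^ 2 := by
  rw [← b.sum_sq_norm_inner_right]
  simp

theorem OrthonormalBasis.inner_self_apply_of_eigen (b : OrthonormalBasis ι ℝ H) {A : H →ₗ[ℝ] H}
    {ev : ι → ℝ} (hA : ∀ i, A (b i) = ev i • b i) (x : H) :
    ⟪x, A x⟫ = ∑ i, ev i * ⟪b i, x⟫ ^ 2 := by
  rw [← b.sum_inner_mul_inner x (A x)]
  refine Finset.sum_congr rfl fun i _ => ?_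
  rw [b.inner_apply_of_eigen hA, real_inner_comm]
  ring

/-- One half of the min-max principle: if `x` is orthogonal to the eigenvectors whose eigenvalue
exceeds `m`, its Rayleigh quotient is at most `m`. -/
theorem OrthonormalBasis.inner_self_apply_le_of_eigen (b : OrthonormalBasis ι ℝ H)
    {A : H →ₗ[ℝ] H} {ev : ι → ℝ} (hA : ∀ i, A (b i) = ev i • b i) {m : ℝ} {x : H}
    (hx : ∀ i, ev i ≤ m ∨ ⟪b i, x⟫ = 0) : ⟪x, A x⟫ ≤ m * ‖x‖ ^ 2 := by
  rw [b.inner_self_apply_of_eigen hA, b.norm_sq_eq_sum, Finset.mul_sum]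
  refine Finset.sum_le_sum fun i _ => ?_
  rcases hx i with h | h
  · exact mul_le_mul_of_nonneg_right h (sq_nonneg _)
  · simp [h]

/-- The other half of the min-max principle. -/
theorem OrthonormalBasis.le_inner_self_apply_of_eigen (b : OrthonormalBasis ι ℝ H)
    {A : H →ₗ[ℝ] H} {ev : ι → ℝ} (hA : ∀ i, A (b i) = ev i • b i) {m : ℝ} {x : H}
    (hx : ∀ i, m ≤ ev i ∨ ⟪b i, x⟫ = 0) : m * ‖x‖ ^ 2 ≤ ⟪x, A x⟫ := by
  rw [b.inner_self_apply_of_eigen hA, b.norm_sq_eq_sum, Finset.mul_sum]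
  refine Finset.sum_le_sum fun i _ => ?_
  rcases hx i with h | h
  · exact mul_le_mul_of_nonneg_right h (sq_nonneg _)
  · simp [h]

/-- The map `I - u uᵀ - v vᵀ`, the projection onto `{u, v}ᗮ` when `u, v` are orthonormal. -/
noncomputable def deflate (u v : H) : H →ₗ[ℝ] H :=
  LinearMap.id - (innerₛₗ ℝ u).smulRight u - (innerₛₗ ℝ v).smulRight v

theorem deflate_apply (u v x : H) : deflate u v x = x - ⟪u, x⟫ • u - ⟪v, x⟫ • v := by
  simp [deflate]

theorem inner_deflate_left (u v x y : H) : ⟪deflate u v x, y⟫ = ⟪x, deflate u v y⟫ := by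
  simp only [deflate_apply, inner_sub_left, inner_sub_right, real_inner_smul_left,
    real_inner_smul_right, real_inner_comm x]
  ring

theorem OrthonormalBasis.inner_deflate (b : OrthonormalBasis ι ℝ H) {i₀ i₁ : ι} (h : i₀ ≠ i₁)
    [DecidableEq ι] (i : ι) (x : H) :
    ⟪b i, deflate (b i₀) (b i₁) x⟫ = if i = i₀ ∨ i = i₁ then 0 else ⟪b i, x⟫ := by
  simp only [deflate_apply, inner_sub_right, real_inner_smul_right,
    orthonormal_iff_ite.1 b.orthonormal]
  rcases eq_or_ne i i₀ with rfl | h0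
  · simp [h]
  · rcases eq_or_ne i i₁ with rfl | h1
    · simp [h0]
    · simp [h0, h1]

theorem OrthonormalBasis.norm_deflate_le (b : OrthonormalBasis ι ℝ H) {i₀ i₁ : ι} (h : i₀ ≠ i₁)
    (x : H) : ‖deflate (b i₀) (b i₁) x‖ ≤ ‖x‖ := by
  classical
  refine abs_le_of_sq_le_sq' ?_ (norm_nonneg _) |>.2
  rw [b.norm_sq_eq_sum, b.norm_sq_eq_sum x]
  refine Finset.sum_le_sum fun i _ => ?_
  rw [b.inner_deflate h]
  split_ifs
  · simpa using sq_nonneg _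
  · exact le_rfl

theorem OrthonormalBasis.deflate_apply_of_eigen (b : OrthonormalBasis ι ℝ H) {A : H →ₗ[ℝ] H}
    {ev : ι → ℝ} (hA : ∀ i, A (b i) = ev i • b i) {i₀ i₁ : ι} (h : i₀ ≠ i₁) (x : H) :
    deflate (b i₀) (b i₁) (A x) = A (deflate (b i₀) (b i₁) x) := by
  classical
  refine b.repr.injective (PiLp.ext fun i => ?_)
  rw [b.repr_apply_apply, b.repr_apply_apply, b.inner_deflate h, b.inner_apply_of_eigen hA, b.inner_apply_of_eigen hA,
    b.inner_deflate h]
  split_ifs <;> simp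

theorem OrthonormalBasis.norm_apply_deflate_le (b : OrthonormalBasis ι ℝ H) {A : H →ₗ[ℝ] H}
    {ev : ι → ℝ} (hA : ∀ i, A (b i) = ev i • b i) {i₀ i₁ : ι} (h : i₀ ≠ i₁) {k : ℝ} (hk : 0 ≤ k)
    (hev : ∀ i, i ≠ i₀ → i ≠ i₁ → |ev i| ≤ k) (x : H) :
    ‖A (deflate (b i₀) (b i₁) x)‖ ≤ k * ‖x‖ := by
  classical
  refine le_trans ?_ (mul_le_mul_of_nonneg_left (b.norm_deflate_le h x) hk)
  refine abs_le_of_sq_le_sq' ?_ (by positivity) |>.2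
  rw [mul_pow, b.norm_sq_eq_sum, b.norm_sq_eq_sum (deflate _ _ x), Finset.mul_sum]
  refine Finset.sum_le_sum fun i _ => ?_
  rw [b.inner_apply_of_eigen hA, mul_pow, b.inner_deflate h]
  split_ifs with hi
  · simp
  · push Not at hi
    exact mul_le_mul_of_nonneg_right (sq_le_sq.2 ((hev i hi.1 hi.2).trans (le_abs_self k)))
      (sq_nonneg _)

theorem OrthonormalBasis.norm_sub_deflate_le (b : OrthonormalBasis ι ℝ H) {A : H →ₗ[ℝ] H}
    {ev : ι → ℝ} (hA : ∀ i, A (b i) = ev i • b i) {i₀ i₁ : ι} (h : i₀ ≠ i₁) {m : ℝ} (hm : 0 ≤ m)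
    (h₀ : m ≤ ev i₀) (h₁ : m ≤ ev i₁) (x : H) :
    m * ‖x - deflate (b i₀) (b i₁) x‖ ≤ ‖A x‖ := by
  classical
  refine abs_le_of_sq_le_sq' ?_ (by positivity) |>.2
  rw [mul_pow, b.norm_sq_eq_sum, b.norm_sq_eq_sum (A x), Finset.mul_sum]
  refine Finset.sum_le_sum fun i _ => ?_
  rw [b.inner_apply_of_eigen hA, inner_sub_right, b.inner_deflate h]
  split_ifs with hi
  · rw [sub_zero, ← mul_pow, mul_pow, mul_pow]
    have : m ≤ ev i := by rcases hi with rfl | rfl <;> assumption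
    exact mul_le_mul_of_nonneg_right (pow_le_pow_left₀ hm this 2) (sq_nonneg _)
  · simpa using by positivity

end Spectral

/-! ### A perturbed block matrix with two communities -/

section TwoBlocks

variable {H : Type*} [NormedAddCommGroup H] [InnerProductSpace ℝ H]

/-- The action on `x` of the mean matrix of a stochastic block model with two communities, whose
indicator vectors are `f` and `g`. -/
noncomputable def blockForm (p q : ℝ) (f g x : H) : H :=
  (p * ⟪f, x⟫ + q * ⟪g, x⟫) • f + (q * ⟪f, x⟫ + p * ⟪g, x⟫) • g

theorem inner_blockForm (p q : ℝ) (f g x : H) :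
    ⟪x, blockForm p q f g x⟫ =
      (p - q) * (⟪f, x⟫ ^ 2 + ⟪g, x⟫ ^ 2) + q * (⟪f, x⟫ + ⟪g, x⟫) ^ 2 := by
  simp only [blockForm, inner_add_right, real_inner_smul_right, real_inner_comm x]
  ring

theorem neg_le_inner_of_norm_le {x z : H} {k : ℝ} (h : ‖z‖ ≤ k * ‖x‖) :
    -(k * ‖x‖ ^ 2) ≤ ⟪x, z⟫ := by
  have := neg_le_of_abs_le (abs_real_inner_le_norm x z)
  nlinarith [norm_nonneg x]

variable {n : ℕ} {A : H →ₗ[ℝ] H} {ev : Fin n → ℝ} {f g : H} {p q k l : ℝ} {Z : H → H}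

/-- On the span of `f` and `g` the quadratic form is at least `(p - q) l - k`, and this plane
contains a vector orthogonal to the first eigenvector. -/
theorem OrthonormalBasis.le_second_eigenvalue (b : OrthonormalBasis (Fin n) ℝ H)
    (hA : ∀ i, A (b i) = ev i • b i) (hev : Antitone ev) (hn : 2 ≤ n)
    (hq : 0 ≤ q) (hqp : q < p) (hfg : ⟪f, g⟫ = 0) (hl : 0 < l) (hf : l ≤ ‖f‖ ^ 2)
    (hg : l ≤ ‖g‖ ^ 2) (hM : ∀ x, A x = blockForm p q f g x + Z x)
    (hZ : ∀ x, ‖Z x‖ ≤ k * ‖x‖) : (p - q) * l - k ≤ ev (Fin.castLE hn 1) := by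
  obtain ⟨a, c, hac, hb⟩ : ∃ a c : ℝ, (a ≠ 0 ∨ c ≠ 0) ∧
      ⟪b (Fin.castLE hn 0), a • f + c • g⟫ = 0 := by
    by_cases h : ⟪b (Fin.castLE hn 0), f⟫ = 0
    · exact ⟨1, 0, by simp, by simp [h]⟩
    · refine ⟨⟪b (Fin.castLE hn 0), g⟫, -⟪b (Fin.castLE hn 0), f⟫, Or.inr (by simpa), ?_⟩
      rw [inner_add_right, real_inner_smul_right, real_inner_smul_right]
      ring
  set x := a • f + c • g with hx
  have hgf : ⟪g, f⟫ = 0 := by rw [real_inner_comm, hfg]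
  have hfx : ⟪f, x⟫ = a * ‖f‖ ^ 2 := by
    rw [hx, inner_add_right, real_inner_smul_right, real_inner_smul_right, hfg,
      real_inner_self_eq_norm_sq]
    ring
  have hgx : ⟪g, x⟫ = c * ‖g‖ ^ 2 := by
    rw [hx, inner_add_right, real_inner_smul_right, real_inner_smul_right, hgf,
      real_inner_self_eq_norm_sq]
    ring
  have hxx : ‖x‖ ^ 2 = a ^ 2 * ‖f‖ ^ 2 + c ^ 2 * ‖g‖ ^ 2 := by
    rw [← real_inner_self_eq_norm_sq, hx, inner_add_left, ← hx, real_inner_smul_left,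
      real_inner_smul_left, hfx, hgx]
    ring
  have hx0 : 0 < ‖x‖ ^ 2 := by
    rw [hxx]
    have hf' := hl.trans_le hf
    have hg' := hl.trans_le hg
    rcases hac with h | h
    · have := sq_pos_of_ne_zero h
      positivity
    · have := sq_pos_of_ne_zero h
      positivity
  have hlow : (p - q) * (l * ‖x‖ ^ 2) ≤ ⟪x, blockForm p q f g x⟫ := by
    have h1 : l * ‖x‖ ^ 2 ≤ ⟪f, x⟫ ^ 2 + ⟪g, x⟫ ^ 2 := by
      rw [hxx, hfx, hgx]
      have h2 := mul_le_mul_of_nonneg_left hf (by positivity : 0 ≤ a ^ 2 * ‖f‖ ^ 2)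
      have h3 := mul_le_mul_of_nonneg_left hg (by positivity : 0 ≤ c ^ 2 * ‖g‖ ^ 2)
      nlinarith
    rw [inner_blockForm]
    have := mul_le_mul_of_nonneg_left h1 (sub_pos.2 hqp).le
    have := mul_nonneg hq (sq_nonneg (⟪f, x⟫ + ⟪g, x⟫))
    linarith
  have hup : ⟪x, A x⟫ ≤ ev (Fin.castLE hn 1) * ‖x‖ ^ 2 := by
    refine b.inner_self_apply_le_of_eigen hA fun i => ?_
    rcases Nat.eq_zero_or_pos i.val with h | h
    · right
      rw [← hb]
      congr 2
      exact Fin.ext h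
    · exact Or.inl (hev (Fin.le_def.2 h))
  have h4 := neg_le_inner_of_norm_le (hZ x)
  rw [hM, inner_add_right] at hup
  refine le_of_mul_le_mul_right ?_ hx0
  linarith

/-- The unperturbed form is positive semidefinite of rank two, so that only the first two
eigenvalues can leave `[-k, k]`. -/
theorem OrthonormalBasis.abs_eigenvalue_le (b : OrthonormalBasis (Fin n) ℝ H)
    (hA : ∀ i, A (b i) = ev i • b i) (hev : Antitone ev) (hn : 2 ≤ n)
    (hq : 0 ≤ q) (hqp : q < p) (hM : ∀ x, A x = blockForm p q f g x + Z x)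
    (hZ : ∀ x, ‖Z x‖ ≤ k * ‖x‖) (i : Fin n) (h0 : i ≠ Fin.castLE hn 0)
    (h1 : i ≠ Fin.castLE hn 1) : |ev i| ≤ k := by
  refine abs_le.2 ⟨?_, ?_⟩
  · have h2 := inner_blockForm p q f g (b i)
    have h3 := neg_le_inner_of_norm_le (hZ (b i))
    have h4 : ⟪b i, A (b i)⟫ = ev i := by
      rw [hA, real_inner_smul_right, real_inner_self_eq_norm_sq, b.orthonormal.1]
      simp
    rw [hM, inner_add_right, h2] at h4
    rw [b.orthonormal.1] at h3
    have h5 := mul_nonneg (sub_pos.2 hqp).le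
      (add_nonneg (sq_nonneg ⟪f, b i⟫) (sq_nonneg ⟪g, b i⟫))
    have h6 := mul_nonneg hq (sq_nonneg (⟪f, b i⟫ + ⟪g, b i⟫))
    linarith
  · have hi : 2 ≤ i.val := by
      have h0' : i.val ≠ 0 := fun h => h0 (Fin.ext h)
      have h1' : i.val ≠ 1 := fun h => h1 (Fin.ext h)
      omega
    have hn3 : 3 ≤ n := by omega
    -- a vector in the span of the first three eigenvectors which the block form kills
    let Φ : (Fin 3 → ℝ) →ₗ[ℝ] H :=
      Fintype.linearCombination ℝ fun j : Fin 3 => b (Fin.castLE hn3 j)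
    have hinj : LinearIndependent ℝ fun j : Fin 3 => b (Fin.castLE hn3 j) :=
      b.orthonormal.linearIndependent.comp _ (Fin.castLE_injective hn3)
    let Ψ : (Fin 3 → ℝ) →ₗ[ℝ] ℝ × ℝ := ((innerₛₗ ℝ f).prod (innerₛₗ ℝ g)).comp Φ
    obtain ⟨a, ha, ha0⟩ := (LinearMap.ker Ψ).ne_bot_iff.1
      (LinearMap.ker_ne_bot_of_finrank_lt (f := Ψ) (by simp))
    have hΨ : ⟪f, Φ a⟫ = 0 ∧ ⟪g, Φ a⟫ = 0 := by
      simpa [Ψ, Prod.ext_iff] using! ha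
    have hx0 : Φ a ≠ 0 := fun h => ha0 <| funext
      (Fintype.linearIndependent_iff.1 hinj a (by simpa [Φ, Fintype.linearCombination_apply] using h))
    have hlow : ev i * ‖Φ a‖ ^ 2 ≤ ⟪Φ a, A (Φ a)⟫ := by
      refine b.le_inner_self_apply_of_eigen hA fun j => ?_
      by_cases hj : j ≤ i
      · exact Or.inl (hev hj)
      · right
        simp only [Φ, Fintype.linearCombination_apply, inner_sum, real_inner_smul_right]
        refine Finset.sum_eq_zero fun m _ => ?_
        rw [b.orthonormal.2, mul_zero]
        intro h
        apply hj
        rw [h, Fin.le_def, Fin.val_castLE]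
        omega
    have hup : ⟪Φ a, A (Φ a)⟫ ≤ k * ‖Φ a‖ ^ 2 := by
      rw [hM, blockForm, hΨ.1, hΨ.2]
      simp only [mul_zero, add_zero, zero_smul, zero_add]
      have h5 := real_inner_le_norm (Φ a) (Z (Φ a))
      nlinarith [hZ (Φ a), norm_nonneg (Φ a)]
    have hx0' : 0 < ‖Φ a‖ ^ 2 := by
      have := norm_pos_iff.2 hx0
      positivity
    exact le_of_mul_le_mul_right (hlow.trans hup) hx0'

end TwoBlocks

/-! ### The leading eigenvector of a perturbed rank-one map -/

section RankOne

variable {H : Type*} [NormedAddCommGroup H] [InnerProductSpace ℝ H]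

/-- A form of the Davis–Kahan theorem: the component orthogonal to `e` of the leading eigenvector
is linear in the perturbation. -/
theorem OrthonormalBasis.mul_norm_sub_inner_smul_le {n : ℕ} (b : OrthonormalBasis (Fin n) ℝ H)
    {T : H →ₗ[ℝ] H} {ev : Fin n → ℝ} (hT : ∀ i, T (b i) = ev i • b i) (hev : Antitone ev)
    (hn : 0 < n) {e : H} (he : ‖e‖ = 1) {c ε : ℝ} (hc : 0 ≤ c)
    (h : ∀ x, ‖T x - (c * ⟪e, x⟫) • e‖ ≤ ε * ‖x‖) :
    c * ‖b ⟨0, hn⟩ - ⟪e, b ⟨0, hn⟩⟫ • e‖ ≤ 2 * ε := by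
  set v := b ⟨0, hn⟩ with hv
  have hv1 : ‖v‖ = 1 := b.orthonormal.1 _
  set r := v - ⟪e, v⟫ • e with hr
  have hee : ⟪e, e⟫ = 1 := by rw [real_inner_self_eq_norm_sq, he]; norm_num
  have hvv : ⟪v, v⟫ = 1 := by rw [real_inner_self_eq_norm_sq, hv1]; norm_num
  have her : ⟪r, e⟫ = 0 := by
    rw [hr, inner_sub_left, real_inner_smul_left, hee, real_inner_comm]; ring
  have hrr : ⟪r, v⟫ = ‖r‖ ^ 2 := by
    have h1 : ⟪r, r⟫ = ⟪r, v⟫ := by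
      conv_lhs => rw [hr, ← hr, inner_sub_right, real_inner_smul_right, her]
      ring
    rw [← h1, real_inner_self_eq_norm_sq]
  have hr1 : ‖r‖ ≤ 1 := by
    have := real_inner_le_norm r v
    rw [hrr, hv1] at this
    nlinarith [norm_nonneg r]
  rcases le_or_gt c (2 * ε) with hcε | hcε
  · nlinarith [norm_nonneg r]
  have h0 : c - ε ≤ ev ⟨0, hn⟩ := by
    have h1 : ⟪e, T e⟫ ≤ ev ⟨0, hn⟩ * ‖e‖ ^ 2 :=
      b.inner_self_apply_le_of_eigen hT fun i => Or.inl (hev (Fin.le_def.2 (Nat.zero_le _)))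
    have h2 := neg_le_inner_of_norm_le (h e)
    rw [inner_sub_right, real_inner_smul_right, hee, he] at h2
    rw [he] at h1
    linarith
  have h1 : ev ⟨0, hn⟩ * ‖r‖ ^ 2 ≤ ‖r‖ * ε := by
    calc ev ⟨0, hn⟩ * ‖r‖ ^ 2 = ⟪r, T v - (c * ⟪e, v⟫) • e⟫ := by
          rw [inner_sub_right, real_inner_smul_right, her, hv, hT, ← hv, real_inner_smul_right, hrr]
          ring
      _ ≤ ‖r‖ * ‖T v - (c * ⟪e, v⟫) • e‖ := real_inner_le_norm _ _
      _ ≤ ‖r‖ * ε := by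
          have := h v
          rw [hv1, mul_one] at this
          gcongr
  rcases (norm_nonneg r).eq_or_lt with h2 | h2
  · have := (norm_nonneg _).trans (h v)
    rw [hv1] at this
    rw [← h2]
    linarith
  · have h3 : ev ⟨0, hn⟩ * ‖r‖ ≤ ε := by
      refine le_of_mul_le_mul_left ?_ h2
      linarith
    nlinarith

/-- The sign of `v` is fixed by a test vector `z` which is not nearly orthogonal to `e`. -/
theorem norm_sub_sq_le_of_inner_nonneg {e v z : H} (he : ‖e‖ = 1) (hv : ‖v‖ = 1)
    (hz : 0 < ⟪z, e⟫) (hz2 : ‖z‖ ^ 2 ≤ 2 * ⟪z, e⟫ ^ 2) (hzv : 0 ≤ ⟪z, v⟫) :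
    ‖v - e‖ ^ 2 ≤ 12 * ‖v - ⟪e, v⟫ • e‖ ^ 2 := by
  set a := ⟪e, v⟫ with ha
  set r := v - a • e with hr
  have hrr : ‖r‖ ^ 2 = 1 - a ^ 2 := by
    rw [hr, norm_sub_sq_real, norm_smul, real_inner_smul_right, real_inner_comm, ← ha, hv, he,
      mul_one, Real.norm_eq_abs, sq_abs]
    ring
  have hve : ‖v - e‖ ^ 2 = 2 - 2 * a := by
    rw [norm_sub_sq_real, hv, he, real_inner_comm, ← ha]
    ring
  rw [hve]
  have ha1 : a ^ 2 ≤ 1 := by nlinarith [sq_nonneg ‖r‖]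
  rcases le_or_gt 0 a with h0 | h0
  · nlinarith
  · have h1 : ⟪z, v⟫ = a * ⟪z, e⟫ + ⟪z, r⟫ := by
      rw [hr, inner_sub_right, real_inner_smul_right]; ring
    have h2 := real_inner_le_norm z r
    have h3 : (-a * ⟪z, e⟫) ^ 2 ≤ (‖z‖ * ‖r‖) ^ 2 :=
      pow_le_pow_left₀ (by nlinarith) (by linarith) 2
    have h4 : a ^ 2 * ⟪z, e⟫ ^ 2 ≤ (2 * ‖r‖ ^ 2) * ⟪z, e⟫ ^ 2 := by
      nlinarith [mul_le_mul_of_nonneg_right hz2 (sq_nonneg ‖r‖)]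
    have h5 := le_of_mul_le_mul_right h4 (by positivity)
    nlinarith

end RankOne

/-! ### Deflating the two-community eigenvectors out of the three-community matrix -/

section Deflation

variable {H : Type*} [NormedAddCommGroup H] [InnerProductSpace ℝ H]

/-- The part of the indicator vector `z` of a community that is orthogonal to the indicator vector
`y + z` of the merged community (where `‖y‖² = l` and `‖z‖² = s`). -/
noncomputable def splitVector (l s : ℝ) (y z : H) : H := z - (s / (l + s)) • (y + z)

section SplitVector

variable {l s : ℝ} {y z : H}

theorem inner_add_splitVector (hl : 0 < l) (hs : 0 < s) (hyz : ⟪y, z⟫ = 0)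
    (hy : ‖y‖ ^ 2 = l) (hz : ‖z‖ ^ 2 = s) : ⟪y + z, splitVector l s y z⟫ = 0 := by
  have hzy : ⟪z, y⟫ = 0 := by rw [real_inner_comm, hyz]
  simp only [splitVector, inner_sub_right, real_inner_smul_right, inner_add_left, inner_add_right,
    hyz, hzy, real_inner_self_eq_norm_sq, hy, hz]
  field_simp
  ring

theorem inner_splitVector (hl : 0 < l) (hs : 0 < s) (hyz : ⟪y, z⟫ = 0)
    (hz : ‖z‖ ^ 2 = s) : ⟪z, splitVector l s y z⟫ = s * l / (l + s) := by
  have hzy : ⟪z, y⟫ = 0 := by rw [real_inner_comm, hyz]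
  simp only [splitVector, inner_sub_right, real_inner_smul_right, inner_add_right,
    hzy, real_inner_self_eq_norm_sq, hz]
  field_simp
  ring

theorem norm_splitVector_sq (hl : 0 < l) (hs : 0 < s) (hyz : ⟪y, z⟫ = 0)
    (hy : ‖y‖ ^ 2 = l) (hz : ‖z‖ ^ 2 = s) : ‖splitVector l s y z‖ ^ 2 = s * l / (l + s) := by
  calc ‖splitVector l s y z‖ ^ 2
      = ⟪z - (s / (l + s)) • (y + z), splitVector l s y z⟫ := (real_inner_self_eq_norm_sq _).symm
    _ = s * l / (l + s) := by
      rw [inner_sub_left, real_inner_smul_left, inner_add_splitVector hl hs hyz hy hz,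
        inner_splitVector hl hs hyz hz]
      ring

end SplitVector

/-- The merged indicator vector `g` is the image under `blockForm` of a short vector. -/
theorem exists_blockForm_eq {p q l m : ℝ} (hq : 0 ≤ q) (hqp : q < p) (hp : p ≤ 1) {f g : H}
    (hfg : ⟪f, g⟫ = 0) (hl : 0 < l) (hlm : l ≤ m) (hf : ‖f‖ ^ 2 = l) (hg : ‖g‖ ^ 2 = m) :
    ∃ y, blockForm p q f g y = g ∧ ‖y‖ ≤ 2 / ((p ^ 2 - q ^ 2) * √l) := by
  have hm : 0 < m := hl.trans_le hlm
  have hD : 0 < p ^ 2 - q ^ 2 := by nlinarith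
  have hgf : ⟪g, f⟫ = 0 := by rw [real_inner_comm, hfg]
  set a := -q / (l * (p ^ 2 - q ^ 2)) with ha
  set c := p / (m * (p ^ 2 - q ^ 2)) with hc
  have h1 : ⟪f, a • f + c • g⟫ = a * l := by
    simp [inner_add_right, real_inner_smul_right, hfg, hf]
  have h2 : ⟪g, a • f + c • g⟫ = c * m := by
    simp [inner_add_right, real_inner_smul_right, hgf, hg]
  refine ⟨a • f + c • g, ?_, ?_⟩
  · rw [blockForm, h1, h2]
    have h3 : p * (a * l) + q * (c * m) = 0 := by
      rw [ha, hc]; field_simp; ring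
    have h4 : q * (a * l) + p * (c * m) = 1 := by
      rw [ha, hc]; field_simp; ring
    rw [h3, h4]
    simp
  · have h3 : ‖a • f + c • g‖ ^ 2 = (q ^ 2 / l + p ^ 2 / m) / (p ^ 2 - q ^ 2) ^ 2 := by
      rw [← real_inner_self_eq_norm_sq, inner_add_left, real_inner_smul_left,
        real_inner_smul_left, h1, h2, ha, hc]
      field_simp
    refine abs_le_of_sq_le_sq' ?_ (by positivity) |>.2
    rw [h3, div_pow, mul_pow, Real.sq_sqrt hl.le, div_le_div_iff₀ (by positivity) (by positivity)]
    have h4 : q ^ 2 / l + p ^ 2 / m ≤ 2 / l := by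
      have : p ^ 2 / m ≤ 1 / l := by
        gcongr
        nlinarith
      have : q ^ 2 / l ≤ 1 / l := by
        gcongr
        nlinarith
      calc _ ≤ 1 / l + 1 / l := by linarith
        _ = 2 / l := by ring
    calc (q ^ 2 / l + p ^ 2 / m) * ((p ^ 2 - q ^ 2) ^ 2 * l)
        ≤ 2 / l * ((p ^ 2 - q ^ 2) ^ 2 * l) := by gcongr
      _ = 2 * (p ^ 2 - q ^ 2) ^ 2 := by field_simp
      _ ≤ 2 ^ 2 * (p ^ 2 - q ^ 2) ^ 2 := by nlinarith [sq_nonneg (p ^ 2 - q ^ 2)]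

theorem norm_inner_smul_le (x y z : H) : ‖⟪y, x⟫ • z‖ ≤ ‖y‖ * ‖z‖ * ‖x‖ := by
  rw [norm_smul, Real.norm_eq_abs]
  calc |⟪y, x⟫| * ‖z‖ ≤ (‖y‖ * ‖x‖) * ‖z‖ := by gcongr; exact abs_real_inner_le_norm y x
    _ = _ := by ring

variable {n : ℕ} {A B : H →ₗ[ℝ] H} {ev : Fin n → ℝ} {f y z : H} {p q l s : ℝ} {ZA ZB : H → H}

/-- Deflation by the two leading eigenvectors of `A` turns the three-community matrix `B` into a
multiple of `w wᵀ`, where `w` is the split vector, up to an error of the order of the noise. The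
vector `w` is in the kernel of the mean of `A`, so it is almost fixed by the deflation, whereas the
merged indicator vector `g = y + z`, of norm at least `√l`, is mapped to a vector of bounded norm
as the mean of `A` maps a vector of norm `O(1 / √l)` to it. -/
theorem OrthonormalBasis.norm_deflate_apply_deflate_sub_le (b : OrthonormalBasis (Fin n) ℝ H)
    (hA : ∀ i, A (b i) = ev i • b i) (hev : Antitone ev) (hn : 2 ≤ n)
    (hq : 0 ≤ q) (hqp : q < p) (hp : p ≤ 1) (hs : 0 < s) (hsl : s ≤ l)
    (hl : 30 * √l ≤ (p - q) * l)
    (hfy : ⟪f, y⟫ = 0) (hfz : ⟪f, z⟫ = 0) (hyz : ⟪y, z⟫ = 0)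
    (hf : ‖f‖ ^ 2 = l) (hy : ‖y‖ ^ 2 = l) (hz : ‖z‖ ^ 2 = s)
    (hMA : ∀ x, A x = blockForm p q f (y + z) x + ZA x) (hZA : ∀ x, ‖ZA x‖ ≤ 15 * √l * ‖x‖)
    (hMB : ∀ x, B x = blockForm p q f (y + z) x - (p - q) • (⟪y, x⟫ • z + ⟪z, x⟫ • y) + ZB x)
    (hZB : ∀ x, ‖ZB x‖ ≤ 15 * √l * ‖x‖) (x : H) :
    ‖deflate (b (Fin.castLE hn 0)) (b (Fin.castLE hn 1))
        (B (deflate (b (Fin.castLE hn 0)) (b (Fin.castLE hn 1)) x)) -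
      (2 * (p - q)) • ⟪splitVector l s y z, x⟫ • splitVector l s y z‖ ≤
      (45 + 600 / (p ^ 2 - q ^ 2)) * √l * ‖x‖ := by
  have hl0 : 0 < l := hs.trans_le hsl
  have hd : 0 < p - q := sub_pos.2 hqp
  have hD : 0 < p ^ 2 - q ^ 2 := by nlinarith
  have hsq : √l * √l = l := Real.mul_self_sqrt hl0.le
  have hsqs : √s ≤ √l := Real.sqrt_le_sqrt hsl
  have hsl0 : 0 < √l := Real.sqrt_pos.2 hl0
  set D := p ^ 2 - q ^ 2 with hDdef
  have hDd : D ≤ 2 * (p - q) := by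
    rw [hDdef]; nlinarith
  set g := y + z with hgdef
  set w := splitVector l s y z with hwdef
  have hne : Fin.castLE hn 0 ≠ Fin.castLE hn 1 := by
    intro h
    simpa using (Fin.castLE_injective hn) h
  have hfg : ⟪f, g⟫ = 0 := by rw [hgdef, inner_add_right, hfy, hfz, add_zero]
  have hg : ‖g‖ ^ 2 = l + s := by
    rw [hgdef, norm_add_sq_real, hyz, hy, hz]; ring
  have hev1 := b.le_second_eigenvalue hA hev hn hq hqp hfg hl0 hf.ge (by rw [hg]; linarith)
    hMA hZA
  have hev0 : ev (Fin.castLE hn 1) ≤ ev (Fin.castLE hn 0) := hev (Fin.le_def.2 (by simp))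
  have hevk := b.abs_eigenvalue_le hA hev hn hq hqp hMA hZA
  have hAQ := b.norm_apply_deflate_le hA hne (k := 15 * √l) (by positivity) hevk
  have hQle := b.norm_deflate_le hne
  have hQA := b.deflate_apply_of_eigen hA hne
  have hw := b.norm_sub_deflate_le hA hne (m := (p - q) * l / 2) (by positivity)
    (by linarith) (by linarith) w
  have hQsymm := inner_deflate_left (b (Fin.castLE hn 0)) (b (Fin.castLE hn 1))
  set Q := deflate (b (Fin.castLE hn 0)) (b (Fin.castLE hn 1)) with hQ
  -- the split vector is almost fixed
  have hgw : ⟪g, w⟫ = 0 := inner_add_splitVector hl0 hs hyz hy hz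
  have hfw : ⟪f, w⟫ = 0 := by
    rw [hwdef, splitVector, ← hgdef, inner_sub_right, real_inner_smul_right, hfg, hfz]; ring
  have hzn : ‖z‖ = √s := by rw [← hz, Real.sqrt_sq (norm_nonneg z)]
  have hwn : ‖w‖ ≤ √s := by
    refine Real.le_sqrt_of_sq_le ?_
    rw [hwdef, norm_splitVector_sq hl0 hs hyz hy hz, div_le_iff₀ (by positivity)]
    nlinarith
  have hwQ : ‖w - Q w‖ ≤ 60 / D := by
    have h1 : A w = ZA w := by rw [hMA, blockForm, hfw, hgw]; simp
    have h2 : (p - q) * l / 2 * ‖w - Q w‖ ≤ 15 * l := by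
      calc _ ≤ ‖A w‖ := hw
        _ ≤ 15 * √l * ‖w‖ := by rw [h1]; exact hZA w
        _ ≤ 15 * √l * √l := by gcongr; exact hwn.trans hsqs
        _ = 15 * l := by rw [mul_assoc, hsq]
    have h3 : (p - q) * ‖w - Q w‖ ≤ 30 := by
      refine le_of_mul_le_mul_right ?_ hl0
      linarith
    rw [le_div_iff₀ hD]
    nlinarith [norm_nonneg (w - Q w)]
  -- the merged indicator vector is almost killed
  have hQg : ‖Q g‖ ≤ 60 / D := by
    obtain ⟨x₀, hx₀, hx₀n⟩ := exists_blockForm_eq hq hqp hp hfg hl0 (by linarith : l ≤ l + s) hf hg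
    have h1 : Q g = A (Q x₀) - Q (ZA x₀) := by
      rw [← hQA, ← map_sub, hMA, hx₀]; simp
    calc ‖Q g‖ ≤ 15 * √l * ‖x₀‖ + 15 * √l * ‖x₀‖ := by
          rw [h1]
          exact (norm_sub_le _ _).trans (add_le_add (hAQ x₀) ((hQle _).trans (hZA x₀)))
      _ ≤ 15 * √l * (2 / (D * √l)) + 15 * √l * (2 / (D * √l)) := by gcongr
      _ = 60 / D := by field_simp; norm_num
  have hQz : ‖Q z - w‖ ≤ 120 / D := by
    have h1 : Q z - w = (s / (l + s)) • Q g - (w - Q w) := by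
      have : z = w + (s / (l + s)) • g := by rw [hwdef, splitVector]; simp [hgdef]
      conv_lhs => rw [this, map_add, map_smul]
      abel
    have h2 : ‖(s / (l + s)) • Q g‖ ≤ 60 / D := by
      rw [norm_smul, Real.norm_of_nonneg (by positivity)]
      have : s / (l + s) ≤ 1 := by
        rw [div_le_one (by positivity)]; linarith
      calc _ ≤ 1 * ‖Q g‖ := by gcongr
        _ ≤ 60 / D := by rwa [one_mul]
    calc _ ≤ 60 / D + 60 / D := by
          rw [h1]; exact (norm_sub_le _ _).trans (add_le_add h2 hwQ)
      _ = 120 / D := by ring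
  have hQzn : ‖Q z‖ ≤ √s := (hQle z).trans hzn.le
  have hQy : Q y = Q g - Q z := by rw [hgdef, map_add]; simp
  -- the expansion of the deflated matrix
  have hexp : Q (B (Q x)) - (2 * (p - q)) • ⟪w, x⟫ • w =
      A (Q (Q x)) - Q (ZA (Q x)) + Q (ZB (Q x)) -
        (p - q) • (⟪Q g, x⟫ • Q z + ⟪Q z, x⟫ • Q g) +
        (2 * (p - q)) • (⟪Q z - w, x⟫ • Q z + ⟪w, x⟫ • (Q z - w)) := by
    have h1 : B (Q x) = A (Q x) - ZA (Q x) + ZB (Q x) -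
        (p - q) • (⟪Q y, x⟫ • z + ⟪Q z, x⟫ • y) := by
      rw [hMB, hMA, hQsymm, hQsymm]; abel
    rw [h1, map_sub, map_add, map_sub, hQA, map_smul, map_add, map_smul, map_smul, hQy,
      inner_sub_left, inner_sub_left]
    module
  have hb1 : ‖A (Q (Q x))‖ ≤ 15 * √l * ‖x‖ := (hAQ _).trans (by gcongr; exact hQle x)
  have hb2 : ‖Q (ZA (Q x))‖ ≤ 15 * √l * ‖x‖ :=
    (hQle _).trans ((hZA _).trans (by gcongr; exact hQle x))
  have hb3 : ‖Q (ZB (Q x))‖ ≤ 15 * √l * ‖x‖ :=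
    (hQle _).trans ((hZB _).trans (by gcongr; exact hQle x))
  have hb4 : ‖⟪Q g, x⟫ • Q z + ⟪Q z, x⟫ • Q g‖ ≤ 120 / D * √l * ‖x‖ := by
    calc _ ≤ ‖Q g‖ * ‖Q z‖ * ‖x‖ + ‖Q z‖ * ‖Q g‖ * ‖x‖ :=
          (norm_add_le _ _).trans (add_le_add (norm_inner_smul_le _ _ _) (norm_inner_smul_le _ _ _))
      _ ≤ 60 / D * √l * ‖x‖ + √l * (60 / D) * ‖x‖ := by
          gcongr <;> exact hQzn.trans hsqs
      _ = _ := by ring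
  have hb5 : ‖⟪Q z - w, x⟫ • Q z + ⟪w, x⟫ • (Q z - w)‖ ≤ 240 / D * √l * ‖x‖ := by
    calc _ ≤ ‖Q z - w‖ * ‖Q z‖ * ‖x‖ + ‖w‖ * ‖Q z - w‖ * ‖x‖ :=
          (norm_add_le _ _).trans (add_le_add (norm_inner_smul_le _ _ _) (norm_inner_smul_le _ _ _))
      _ ≤ 120 / D * √l * ‖x‖ + √l * (120 / D) * ‖x‖ := by
          gcongr
          · exact hQzn.trans hsqs
          · exact hwn.trans hsqs
      _ = _ := by ring
  have hp1 : p - q ≤ 1 := by linarith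
  rw [hexp]
  calc _ ≤ ‖A (Q (Q x))‖ + ‖Q (ZA (Q x))‖ + ‖Q (ZB (Q x))‖ +
        ‖(p - q) • (⟪Q g, x⟫ • Q z + ⟪Q z, x⟫ • Q g)‖ +
        ‖(2 * (p - q)) • (⟪Q z - w, x⟫ • Q z + ⟪w, x⟫ • (Q z - w))‖ := by
        refine (norm_add_le _ _).trans (add_le_add_left ?_ _)
        refine (norm_sub_le _ _).trans (add_le_add_left ?_ _)
        refine (norm_add_le _ _).trans (add_le_add_left ?_ _)
        exact norm_sub_le _ _
    _ ≤ 15 * √l * ‖x‖ + 15 * √l * ‖x‖ + 15 * √l * ‖x‖ + 1 * (120 / D * √l * ‖x‖) +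
        2 * (240 / D * √l * ‖x‖) := by
        rw [norm_smul, norm_smul, Real.norm_of_nonneg hd.le, Real.norm_of_nonneg (by positivity)]
        gcongr
        linarith
    _ = _ := by ring

/-- The leading eigenvector of the deflated matrix is close to the normalized split vector. -/
theorem OrthonormalBasis.norm_sub_normalized_splitVector_sq_le (b b' : OrthonormalBasis (Fin n) ℝ H)
    {ev' : Fin n → ℝ}
    (hA : ∀ i, A (b i) = ev i • b i) (hev : Antitone ev) (hn : 2 ≤ n)
    (hq : 0 ≤ q) (hqp : q < p) (hp : p ≤ 1) (hs : 0 < s) (hsl : s ≤ l)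
    (hl : 30 * √l ≤ (p - q) * l)
    (hfy : ⟪f, y⟫ = 0) (hfz : ⟪f, z⟫ = 0) (hyz : ⟪y, z⟫ = 0)
    (hf : ‖f‖ ^ 2 = l) (hy : ‖y‖ ^ 2 = l) (hz : ‖z‖ ^ 2 = s)
    (hMA : ∀ x, A x = blockForm p q f (y + z) x + ZA x) (hZA : ∀ x, ‖ZA x‖ ≤ 15 * √l * ‖x‖)
    (hMB : ∀ x, B x = blockForm p q f (y + z) x - (p - q) • (⟪y, x⟫ • z + ⟪z, x⟫ • y) + ZB x)
    (hZB : ∀ x, ‖ZB x‖ ≤ 15 * √l * ‖x‖)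
    (hT : ∀ i, deflate (b (Fin.castLE hn 0)) (b (Fin.castLE hn 1))
        (B (deflate (b (Fin.castLE hn 0)) (b (Fin.castLE hn 1)) (b' i))) = ev' i • b' i)
    (hev' : Antitone ev') (hn0 : 0 < n) (hzv : 0 ≤ ⟪z, b' ⟨0, hn0⟩⟫) :
    ‖b' ⟨0, hn0⟩ - (√(s * l / (l + s)))⁻¹ • splitVector l s y z‖ ^ 2 ≤
      48 * (45 + 600 / (p ^ 2 - q ^ 2)) ^ 2 / (p - q) ^ 2 * (l / s ^ 2) := by
  have hl0 : 0 < l := hs.trans_le hsl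
  have hd : 0 < p - q := sub_pos.2 hqp
  have hD : 0 < p ^ 2 - q ^ 2 := by nlinarith
  have hS : s / 2 ≤ s * l / (l + s) := by
    rw [div_le_div_iff₀ (by norm_num) (by positivity)]
    nlinarith
  have hS0 : 0 < s * l / (l + s) := by positivity
  have hzw := inner_splitVector hl0 hs hyz hz
  have hww := norm_splitVector_sq hl0 hs hyz hy hz
  have key := b.norm_deflate_apply_deflate_sub_le hA hev hn hq hqp hp hs hsl hl hfy hfz hyz hf hy hz
    hMA hZA hMB hZB
  set w := splitVector l s y z with hw
  set S := s * l / (l + s) with hSdef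
  set C := 45 + 600 / (p ^ 2 - q ^ 2) with hC
  have hC0 : 0 < C := by positivity
  have hSS : √S * √S = S := Real.mul_self_sqrt hS0.le
  have hS1 : 0 < √S := Real.sqrt_pos.2 hS0
  set e := (√S)⁻¹ • w with he
  have hwn : ‖w‖ = √S := by rw [← hww, Real.sqrt_sq (norm_nonneg w)]
  have he1 : ‖e‖ = 1 := by
    rw [he, norm_smul, norm_inv, Real.norm_of_nonneg hS1.le, hwn, inv_mul_cancel₀ hS1.ne']
  have hze : ⟪z, e⟫ = √S := by
    rw [he, real_inner_smul_right, hzw]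
    field_simp
    linarith
  have hrank : ∀ x, (2 * (p - q) * S * ⟪e, x⟫) • e = (2 * (p - q)) • ⟪w, x⟫ • w := by
    intro x
    rw [he, real_inner_smul_left, smul_smul, smul_smul]
    congr 1
    field_simp
    rw [pow_two, hSS]
  have h1 := b'.mul_norm_sub_inner_smul_le
    (T := deflate (b (Fin.castLE hn 0)) (b (Fin.castLE hn 1)) ∘ₗ B ∘ₗ
      deflate (b (Fin.castLE hn 0)) (b (Fin.castLE hn 1))) hT hev' hn0 he1
    (c := 2 * (p - q) * S) (ε := C * √l) (by positivity) (fun x => by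
      rw [hrank]; exact key x)
  have h2 := norm_sub_sq_le_of_inner_nonneg he1 (b'.orthonormal.1 ⟨0, hn0⟩) (z := z)
    (by rw [hze]; exact hS1) (by rw [hze, hz, pow_two, hSS]; linarith) hzv
  set r := b' ⟨0, hn0⟩ - ⟪e, b' ⟨0, hn0⟩⟫ • e with hr
  refine h2.trans ?_
  have h3 : (p - q) * s * ‖r‖ ≤ 2 * (C * √l) := by
    have : (p - q) * s ≤ 2 * (p - q) * S := by nlinarith
    exact (mul_le_mul_of_nonneg_right this (norm_nonneg r)).trans h1
  have h4 : ((p - q) * s * ‖r‖) ^ 2 ≤ (2 * (C * √l)) ^ 2 :=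
    pow_le_pow_left₀ (by positivity) h3 2
  have h5 : (2 * (C * √l)) ^ 2 = 4 * C ^ 2 * l := by
    rw [mul_pow, mul_pow, Real.sq_sqrt hl0.le]; ring
  rw [h5] at h4
  rw [div_mul_div_comm, le_div_iff₀ (by positivity)]
  nlinarith

end Deflation

/-! ### The block model with communities of sizes `l`, `l` and `s` -/

namespace TwoSBM

section Communities

variable {l s : ℕ}

/-- The indicator vector of a community of the finer partition. -/
noncomputable def indicatorVec (l s : ℕ) (k : Fin 3) : EuclideanSpace ℝ (Node l s) :=
  WithLp.toLp 2 fun i => if commB i = k then 1 else 0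

theorem inner_indicatorVec_zero (x : EuclideanSpace ℝ (Node l s)) :
    ⟪indicatorVec l s 0, x⟫ = ∑ i, x (Sum.inl i) := by
  simp [indicatorVec, PiLp.inner_apply, commB]

theorem inner_indicatorVec_one (x : EuclideanSpace ℝ (Node l s)) :
    ⟪indicatorVec l s 1, x⟫ = ∑ i, x (Sum.inr (Sum.inl i)) := by
  simp [indicatorVec, PiLp.inner_apply, commB]

theorem inner_indicatorVec_two (x : EuclideanSpace ℝ (Node l s)) :
    ⟪indicatorVec l s 2, x⟫ = ∑ i, x (Sum.inr (Sum.inr i)) := by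
  simp [indicatorVec, PiLp.inner_apply, commB]

theorem inner_indicatorVec_of_ne {j k : Fin 3} (h : j ≠ k) :
    ⟪indicatorVec l s j, indicatorVec l s k⟫ = 0 := by
  simp only [indicatorVec, PiLp.inner_apply]
  refine Finset.sum_eq_zero fun i _ => ?_
  by_cases hi : commB i = j
  · simp [hi, h]
  · simp [hi]

theorem norm_indicatorVec_zero_sq : ‖indicatorVec l s 0‖ ^ 2 = l := by
  rw [← real_inner_self_eq_norm_sq, inner_indicatorVec_zero]
  simp [indicatorVec, commB]

theorem norm_indicatorVec_one_sq : ‖indicatorVec l s 1‖ ^ 2 = l := by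
  rw [← real_inner_self_eq_norm_sq, inner_indicatorVec_one]
  simp [indicatorVec, commB]

theorem norm_indicatorVec_two_sq : ‖indicatorVec l s 2‖ ^ 2 = s := by
  rw [← real_inner_self_eq_norm_sq, inner_indicatorVec_two]
  simp [indicatorVec, commB]

theorem toEuclideanCLM_blockMean_commA (p q : ℝ) (x : EuclideanSpace ℝ (Node l s)) :
    Matrix.toEuclideanCLM (𝕜 := ℝ) (blockMean commA p q) x =
      blockForm p q (indicatorVec l s 0) (indicatorVec l s 1 + indicatorVec l s 2) x := by
  ext i
  rw [blockForm, inner_add_left, inner_indicatorVec_zero, inner_indicatorVec_one,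
    inner_indicatorVec_two]
  rcases i with i | i | i <;>
  · simp [Matrix.mulVec, dotProduct, blockMean, commA, indicatorVec, commB, ← Finset.mul_sum]
    try ring

theorem toEuclideanCLM_blockMean_commB (p q : ℝ) (x : EuclideanSpace ℝ (Node l s)) :
    Matrix.toEuclideanCLM (𝕜 := ℝ) (blockMean commB p q) x =
      blockForm p q (indicatorVec l s 0) (indicatorVec l s 1 + indicatorVec l s 2) x -
        (p - q) • (⟪indicatorVec l s 1, x⟫ • indicatorVec l s 2 +
          ⟪indicatorVec l s 2, x⟫ • indicatorVec l s 1) := by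
  ext i
  rw [blockForm, inner_add_left, inner_indicatorVec_zero, inner_indicatorVec_one,
    inner_indicatorVec_two]
  rcases i with i | i | i <;>
  · simp [Matrix.mulVec, dotProduct, blockMean, indicatorVec, commB, ← Finset.mul_sum]
    try ring

theorem toEuclideanCLM_complementProj {V : Type*} [Fintype V] [DecidableEq V]
    (u : Fin 2 → EuclideanSpace ℝ V) (x : EuclideanSpace ℝ V) :
    Matrix.toEuclideanCLM (𝕜 := ℝ) (complementProj u) x = deflate (u 0) (u 1) x := by
  ext i
  rw [deflate_apply]
  simp [complementProj, Matrix.vecMulVec_mulVec, PiLp.inner_apply, dotProduct,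
    mul_comm]

/-- A node can only be misclassified if `v` and `e` differ there by at least `1 / (5 √s)`. -/
theorem numErrors_le (hs : 0 < s) {v e : EuclideanSpace ℝ (Node l s)}
    (h1 : ∀ i, commB i = 2 → 7 / 10 ≤ √s * e i) (h2 : ∀ i, commB i ≠ 2 → e i ≤ 0) :
    (numErrors v : ℝ) ≤ 25 * s * ‖v - e‖ ^ 2 := by
  classical
  have hs' : (0 : ℝ) < s := by exact_mod_cast hs
  have hsq : 0 < √(s : ℝ) := Real.sqrt_pos.2 hs'
  have hss : √(s : ℝ) ^ 2 = s := Real.sq_sqrt hs'.le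
  have hthr : √(s : ℝ) * (1 / (2 * √(s : ℝ))) = 1 / 2 := by field_simp
  rw [numErrors, Set.ncard_eq_toFinset_card', EuclideanSpace.real_norm_sq_eq, Finset.mul_sum,
    Finset.card_eq_sum_ones]
  push_cast
  refine le_trans (Finset.sum_le_sum fun i hi => ?_)
    (Finset.sum_le_sum_of_subset_of_nonneg (Finset.subset_univ _) fun i _ _ => by positivity)
  rw [Set.mem_toFinset, Set.mem_symmDiff] at hi
  have key : 25 * (s : ℝ) * (v - e) i ^ 2 = 25 * (√s * v i - √s * e i) ^ 2 := by
    simp only [PiLp.sub_apply]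
    linear_combination (-25 * (v i - e i) ^ 2) * hss
  rw [key]
  rcases hi with ⟨hi, hg⟩ | ⟨hg, hi⟩
  · have h3 : 1 / (2 * √(s : ℝ)) < v i := hi
    have h4 := mul_lt_mul_of_pos_left h3 hsq
    have h5 := mul_nonpos_of_nonneg_of_nonpos hsq.le (h2 i hg)
    rw [hthr] at h4
    nlinarith
  · have h3 : v i ≤ 1 / (2 * √(s : ℝ)) := not_lt.1 hi
    have h4 := mul_le_mul_of_nonneg_left h3 hsq.le
    have h5 := h1 i hg
    rw [hthr] at h4
    nlinarith

theorem normalized_splitVector_apply_of_eq (hs : 0 < s) (hsl : s ≤ l) {i : Node l s}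
    (hi : commB i = 2) :
    7 / 10 ≤ √(s : ℝ) * ((√(s * l / (l + s) : ℝ))⁻¹ •
      splitVector (l : ℝ) s (indicatorVec l s 1) (indicatorVec l s 2)) i := by
  have hs' : (0 : ℝ) < s := by exact_mod_cast hs
  have hsl' : (s : ℝ) ≤ l := by exact_mod_cast hsl
  have hl' : (0 : ℝ) < l := hs'.trans_le hsl'
  have hS : 0 < √(s * l / (l + s) : ℝ) := Real.sqrt_pos.2 (by positivity)
  have h1 : ((√(s * l / (l + s) : ℝ))⁻¹ •
      splitVector (l : ℝ) s (indicatorVec l s 1) (indicatorVec l s 2)) i =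
      (√(s * l / (l + s) : ℝ))⁻¹ * (l / (l + s)) := by
    simp [splitVector, indicatorVec, hi]
    left
    field_simp
    ring
  rw [h1, mul_left_comm, ← div_eq_inv_mul, le_div_iff₀ hS]
  refine abs_le_of_sq_le_sq' ?_ (by positivity) |>.2
  rw [mul_pow, mul_pow, Real.sq_sqrt (by positivity), Real.sq_sqrt hs'.le]
  have h2 : (1 : ℝ) / 2 ≤ l / (l + s) := by
    rw [div_le_div_iff₀ (by norm_num) (by positivity)]; linarith
  rw [mul_div_assoc]
  have h3 : 0 < (l : ℝ) / (l + s) := by positivity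
  nlinarith [mul_le_mul_of_nonneg_left h2 (mul_pos hs' h3).le]

theorem normalized_splitVector_apply_nonpos {i : Node l s} (hi : commB i ≠ 2) :
    ((√(s * l / (l + s) : ℝ))⁻¹ •
      splitVector (l : ℝ) s (indicatorVec l s 1) (indicatorVec l s 2)) i ≤ 0 := by
  have h1 : (0 : ℝ) ≤ if commB i = 1 then 1 else 0 := by split_ifs <;> norm_num
  have h2 : 0 ≤ (√(s * l / (l + s) : ℝ))⁻¹ * (s / (l + s) * if commB i = 1 then 1 else 0) := by
    positivity
  simp only [splitVector, indicatorVec, PiLp.smul_apply, PiLp.sub_apply, PiLp.add_apply, hi,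
    if_false, smul_eq_mul]
  linarith

end Communities

/-- The deterministic part of the estimate: both matrices are within `15 √l` of their means. -/
theorem numErrors_div_le {l s : ℕ} {p q : ℝ} (hq : 0 ≤ q) (hqp : q < p) (hp : p ≤ 1)
    (hs : 0 < s) (hsl : s ≤ l) (hl : 30 * √(l : ℝ) ≤ (p - q) * l)
    {WA WB : Matrix (Node l s) (Node l s) ℝ}
    (hWA : ‖Matrix.toEuclideanCLM (n := Node l s) (𝕜 := ℝ) (WA - blockMean commA p q)‖ ≤ 15 * √(l : ℝ))
    (hWB : ‖Matrix.toEuclideanCLM (n := Node l s) (𝕜 := ℝ) (WB - blockMean commB p q)‖ ≤ 15 * √(l : ℝ))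
    {u : Fin 2 → EuclideanSpace ℝ (Node l s)} {v : EuclideanSpace ℝ (Node l s)}
    (hu : AreLeadingEigenvectors WA u)
    (hv : AreLeadingEigenvectors (complementProj u * WB * complementProj u) ![v])
    (hpos : 0 ≤ ∑ k : Fin s, v (Sum.inr (Sum.inr k))) :
    (numErrors v : ℝ) / s ≤
      1200 * (45 + 600 / (p ^ 2 - q ^ 2)) ^ 2 / (p - q) ^ 2 * (l / (s : ℝ) ^ 2) := by
  have hs' : (0 : ℝ) < s := by exact_mod_cast hs
  obtain ⟨b, ev, hn, hev, hb, hub⟩ := hu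
  obtain ⟨b', ev', hn1, hev', hb', hvb⟩ := hv
  have hv0 : v = b' ⟨0, hn1⟩ := hvb 0
  have hsplit : ∀ (W M : Matrix (Node l s) (Node l s) ℝ) x,
      Matrix.toEuclideanCLM (n := Node l s) (𝕜 := ℝ) W x =
        Matrix.toEuclideanCLM (n := Node l s) (𝕜 := ℝ) M x + Matrix.toEuclideanCLM (n := Node l s) (𝕜 := ℝ) (W - M) x := by
    intro W M x
    rw [map_sub]; simp
  have hmain := b.norm_sub_normalized_splitVector_sq_le b' (ev' := ev') (p := p) (q := q)
    (l := (l : ℝ)) (s := (s : ℝ))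
    (A := (Matrix.toEuclideanCLM (n := Node l s) (𝕜 := ℝ) WA : _ →L[ℝ] _).toLinearMap)
    (B := (Matrix.toEuclideanCLM (n := Node l s) (𝕜 := ℝ) WB : _ →L[ℝ] _).toLinearMap)
    (f := indicatorVec l s 0) (y := indicatorVec l s 1) (z := indicatorVec l s 2)
    (ZA := fun x => Matrix.toEuclideanCLM (n := Node l s) (𝕜 := ℝ) (WA - blockMean commA p q) x)
    (ZB := fun x => Matrix.toEuclideanCLM (n := Node l s) (𝕜 := ℝ) (WB - blockMean commB p q) x)
    (fun i => WithLp.ofLp_injective 2 (hb i)) hev hn hq hqp hp hs' (by exact_mod_cast hsl) hl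
    (inner_indicatorVec_of_ne (by decide)) (inner_indicatorVec_of_ne (by decide))
    (inner_indicatorVec_of_ne (by decide)) norm_indicatorVec_zero_sq norm_indicatorVec_one_sq
    norm_indicatorVec_two_sq
    (fun x => by rw [← toEuclideanCLM_blockMean_commA]; exact hsplit _ _ x)
    (fun x => (ContinuousLinearMap.le_opNorm _ x).trans (by gcongr))
    (fun x => by rw [← toEuclideanCLM_blockMean_commB]; exact hsplit _ _ x)
    (fun x => (ContinuousLinearMap.le_opNorm _ x).trans (by gcongr))
    (fun i => by
      rw [← hub 0, ← hub 1, ← toEuclideanCLM_complementProj, ← toEuclideanCLM_complementProj]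
      refine WithLp.ofLp_injective 2 ?_
      refine Eq.trans ?_ (hb' i)
      simp [← Matrix.mulVec_mulVec])
    hev' hn1 (by rw [inner_indicatorVec_two, ← hv0]; exact hpos)
  rw [← hv0] at hmain
  have hcount := numErrors_le hs (v := v)
    (fun i hi => normalized_splitVector_apply_of_eq hs hsl hi)
    (fun i hi => normalized_splitVector_apply_nonpos hi)
  rw [div_le_iff₀ hs']
  refine hcount.trans ?_
  have := mul_le_mul_of_nonneg_left hmain (by positivity : (0 : ℝ) ≤ 25 * s)
  refine this.trans (le_of_eq ?_)
  ring

/-- The constant `15` beats the entropy `25 ^ (3 l)` of the net. -/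
theorem IsSBM.measureReal_opNorm_gt_le_exp {Ω K : Type*} [MeasurableSpace Ω] [DecidableEq K]
    {μ : Measure Ω} [IsProbabilityMeasure μ] {l s : ℕ} {X : Sym2 (Node l s) → Ω → ℝ}
    {c : Node l s → K} {p q : ℝ} (h : IsSBM μ X c p q) (hl : 0 < l) (hsl : s ≤ l) :
    μ.real {ω | 15 * √(l : ℝ) <
      ‖Matrix.toEuclideanCLM (n := Node l s) (𝕜 := ℝ) (weightMatrix X ω - blockMean c p q)‖} ≤
      Real.exp (-(2 * l)) := by
  have hl' : (0 : ℝ) < l := by exact_mod_cast hl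
  refine (h.measureReal_opNorm_gt_le (t := 15 * √(l : ℝ)) (by positivity)).trans ?_
  have hcard : Fintype.card (Node l s) ≤ 3 * l := by
    simp [Node]; omega
  have h25 : (25 : ℝ) ≤ Real.exp 4 := by
    have h1 : Real.exp 4 = Real.exp 1 ^ 4 := by rw [← Real.exp_nat_mul]; norm_num
    have h2 : (5 / 2 : ℝ) ≤ Real.exp 1 := by linarith [Real.exp_one_gt_d9]
    calc (25 : ℝ) ≤ (5 / 2) ^ 4 := by norm_num
      _ ≤ Real.exp 4 := by rw [h1]; gcongr
  calc _ ≤ Real.exp 4 ^ (3 * l) * Real.exp (-(15 * √(l : ℝ)) ^ 2 / 16) := by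
        gcongr
        exact (pow_le_pow_right₀ (by norm_num) hcard).trans (by gcongr)
    _ = Real.exp (12 * l - 225 / 16 * l) := by
        rw [← Real.exp_nat_mul, ← Real.exp_add, mul_pow, Real.sq_sqrt hl'.le]
        congr 1
        push_cast
        ring
    _ ≤ _ := Real.exp_le_exp.2 (by linarith)

end TwoSBM

theorem theorem1 (p q : ℝ) (hq : 0 ≤ q) (hqp : q < p) (hp : p ≤ 1) :
    ∃ C₂ C₃ : ℝ, 0 < C₂ ∧ 0 < C₃ ∧ ∃ L : ℕ,
      ∀ (l s : ℕ) (α : ℝ), L ≤ l → L ≤ s → 1 / 2 < α → α < 1 → (s : ℝ) = (l : ℝ) ^ α →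
      ∀ {Ω : Type*} [MeasurableSpace Ω] (μ : MeasureTheory.Measure Ω)
        [MeasureTheory.IsProbabilityMeasure μ]
        (XA XB : Sym2 (TwoSBM.Node l s) → Ω → ℝ),
        TwoSBM.IsSBM μ XA TwoSBM.commA p q →
        TwoSBM.IsSBM μ XB TwoSBM.commB p q →
        1 - Real.exp (-(l : ℝ)) ≤
          μ.real {ω |
            ∀ (u : Fin 2 → EuclideanSpace ℝ (TwoSBM.Node l s))
              (v : EuclideanSpace ℝ (TwoSBM.Node l s)),
              TwoSBM.AreLeadingEigenvectors (TwoSBM.weightMatrix XA ω) u →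
              TwoSBM.AreLeadingEigenvectors
                (TwoSBM.complementProj u * TwoSBM.weightMatrix XB ω * TwoSBM.complementProj u)
                ![v] →
              0 ≤ ∑ k : Fin s, v (Sum.inr (Sum.inr k)) →
              (TwoSBM.numErrors v : ℝ) / s ≤
                if α ≤ 2 / 3 then C₂ * (l : ℝ) ^ (1 - 2 * α) else C₃ * (l : ℝ) ^ (α - 1)} := by
  have hd : 0 < p - q := sub_pos.2 hqp
  have hD : 0 < p ^ 2 - q ^ 2 := by nlinarith
  set C := 1200 * (45 + 600 / (p ^ 2 - q ^ 2)) ^ 2 / (p - q) ^ 2 with hC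
  have hC0 : 0 < C := by positivity
  refine ⟨C, C, hC0, hC0, ⌈(30 / (p - q)) ^ 2⌉₊ + 1, ?_⟩
  intro l s α hLl hLs hα1 hα2 hsα Ω _ μ _ XA XB hA hB
  have hl : 0 < l := by omega
  have hs : 0 < s := by omega
  have hl1 : (1 : ℝ) ≤ l := by exact_mod_cast hl
  have hsl : s ≤ l := by
    have : (s : ℝ) ≤ (l : ℝ) := by
      rw [hsα]
      exact (Real.rpow_le_rpow_of_exponent_le hl1 hα2.le).trans_eq (Real.rpow_one _)
    exact_mod_cast this
  have hlarge : 30 * √(l : ℝ) ≤ (p - q) * l := by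
    have h1 : (30 / (p - q)) ^ 2 ≤ l := (Nat.le_ceil _).trans (by exact_mod_cast by omega)
    have h2 : 30 / (p - q) ≤ √(l : ℝ) := Real.le_sqrt_of_sq_le h1
    rw [div_le_iff₀ hd] at h2
    have h3 := mul_le_mul_of_nonneg_right h2 (Real.sqrt_nonneg (l : ℝ))
    have h4 : √(l : ℝ) * √(l : ℝ) = l := Real.mul_self_sqrt (by positivity)
    linear_combination h3 + (p - q) * h4
  have hrate : (l : ℝ) / (s : ℝ) ^ 2 = (l : ℝ) ^ (1 - 2 * α) := by
    have hl0 : (0 : ℝ) < l := by positivity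
    rw [hsα, Real.rpow_sub hl0, Real.rpow_one, mul_comm 2 α, Real.rpow_mul hl0.le]
    norm_num
  set good := {ω | ∀ (u : Fin 2 → EuclideanSpace ℝ (TwoSBM.Node l s))
    (v : EuclideanSpace ℝ (TwoSBM.Node l s)),
    TwoSBM.AreLeadingEigenvectors (TwoSBM.weightMatrix XA ω) u →
    TwoSBM.AreLeadingEigenvectors
      (TwoSBM.complementProj u * TwoSBM.weightMatrix XB ω * TwoSBM.complementProj u) ![v] →
    0 ≤ ∑ k : Fin s, v (Sum.inr (Sum.inr k)) →
    (TwoSBM.numErrors v : ℝ) / s ≤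
      if α ≤ 2 / 3 then C * (l : ℝ) ^ (1 - 2 * α) else C * (l : ℝ) ^ (α - 1)} with hgood
  set badA := {ω | 15 * √(l : ℝ) < ‖Matrix.toEuclideanCLM (n := TwoSBM.Node l s) (𝕜 := ℝ)
    (TwoSBM.weightMatrix XA ω - TwoSBM.blockMean TwoSBM.commA p q)‖} with hbadA
  set badB := {ω | 15 * √(l : ℝ) < ‖Matrix.toEuclideanCLM (n := TwoSBM.Node l s) (𝕜 := ℝ)
    (TwoSBM.weightMatrix XB ω - TwoSBM.blockMean TwoSBM.commB p q)‖} with hbadB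
  have hcover : Set.univ ⊆ good ∪ (badA ∪ badB) := by
    intro ω _
    by_cases h : ω ∈ badA ∪ badB
    · exact Or.inr h
    left
    have hωA : ‖Matrix.toEuclideanCLM (n := TwoSBM.Node l s) (𝕜 := ℝ)
        (TwoSBM.weightMatrix XA ω - TwoSBM.blockMean TwoSBM.commA p q)‖ ≤ 15 * √(l : ℝ) :=
      not_lt.1 fun h' => h (Or.inl h')
    have hωB : ‖Matrix.toEuclideanCLM (n := TwoSBM.Node l s) (𝕜 := ℝ)
        (TwoSBM.weightMatrix XB ω - TwoSBM.blockMean TwoSBM.commB p q)‖ ≤ 15 * √(l : ℝ) :=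
      not_lt.1 fun h' => h (Or.inr h')
    intro u v hu hv hpos
    have key := TwoSBM.numErrors_div_le hq hqp hp hs hsl hlarge hωA hωB hu hv hpos
    rw [hrate, ← hC] at key
    split_ifs with hα
    · exact key
    · -- `1 - 2 α ≤ α - 1` exactly when `2 / 3 ≤ α`
      exact key.trans (mul_le_mul_of_nonneg_left
        (Real.rpow_le_rpow_of_exponent_le hl1 (by linarith)) hC0.le)
  have hprob : (1 : ℝ) ≤ μ.real good + (μ.real badA + μ.real badB) := by
    calc (1 : ℝ) = μ.real Set.univ := by simp
      _ ≤ μ.real (good ∪ (badA ∪ badB)) := measureReal_mono hcover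
      _ ≤ μ.real good + μ.real (badA ∪ badB) := measureReal_union_le _ _
      _ ≤ _ := by gcongr; exact measureReal_union_le _ _
  have hbA := hA.measureReal_opNorm_gt_le_exp hl hsl
  have hbB := hB.measureReal_opNorm_gt_le_exp hl hsl
  have hexp : 2 * Real.exp (-(2 * l : ℝ)) ≤ Real.exp (-(l : ℝ)) := by
    have h1 : Real.exp (-(l : ℝ)) = Real.exp (l : ℝ) * Real.exp (-(2 * l : ℝ)) := by
      rw [← Real.exp_add]; congr 1; ring
    rw [h1]
    gcongr
    linarith [Real.add_one_le_exp (l : ℝ)]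
  linarith
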